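/- Let $n\ge 2$, $S=\mathbb{C}[x_0,\dots,x_n]$ and let $\omega=\sum_{i=0}^n A_i\,dx_i\in\mathcal{F}^1(\mathbb{P}^n,e)$ be a codimension one foliation of degree $e-2$ on $\mathbb{P}^n=\mathbb{P}^n_{\mathbb{C}}$: that is, $e\ge 2$, the $A_i\in S$ are homogeneous of degree $e-1$, $\sum_i x_iA_i=0$, $\omega\wedge d\omega=0$, and the singular locus $\{A_0=\dots=A_n=0\}$ has codimension at least $2$. Let $J=(A_0,\dots,A_n)\subseteq S$ be the singular ideal and let $$K=\operatorname{ann}(\overline{d\omega})+J,\qquad \overline{d\omega}\in\Omega^2_S\otimes_S S/J .$$ Let the Kupka scheme be the closed subscheme $\mathcal{K}=\operatorname{Proj}(S/K)$ of $\mathbb{P}^n$, and let the Kupka set $\mathcal{K}_{set}$ be the Zariski closure in $\mathbb{P}^n$, with its reduced structure, of the set of Kupka points, i.e. of the points where $\omega$ vanishes and $d\omega$ does not. If $J$ is radical, then $$\mathcal{K}=\mathcal{K}_{set}\neq\emptyset$$ (equality of closed subschemes of $\mathbb{P}^n$). In particular $\omega$ has a Kupka point: there is $v\in\mathbb{C}^{n+1}\setminus\{0\}$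 at which all the coefficients of $\omega$ vanish and some coefficient of $d\omega$ does not. -/

import Mathlib

open AlgebraicGeometry TopologicalSpace Opposite
open scoped TensorProduct

noncomputable section

namespace KupkaFoliation

/-- `S = ℂ[x_0, …, x_n]`, the homogeneous coordinate ring of `ℙⁿ`. -/
abbrev S (n : ℕ) : Type := MvPolynomial (Fin (n + 1)) ℂ

/-- The module of polynomial `1`-forms `Ω¹_S` (Kähler differentials); it is free on the `dx_i`. -/
abbrev Form1 (n : ℕ) : Type := Ω[S n⁄ℂ]

/-- The module of polynomial `2`-forms `Ω²_S`. -/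
abbrev Form2 (n : ℕ) : Type := ⋀[S n]^2 (Form1 n)

/-- The basis `dx_0, …, dx_n` of `Ω¹_S`. -/
def dxBasis (n : ℕ) : Module.Basis (Fin (n + 1)) (S n) (Form1 n) :=
  KaehlerDifferential.mvPolynomialBasis ℂ (Fin (n + 1))

/-- The coefficient `A_i` of `ω = ∑ A_i dx_i`. -/
def formCoeff {n : ℕ} (ω : Form1 n) (i : Fin (n + 1)) : S n := (dxBasis n).repr ω i

/-- The exterior derivative `dω = ∑ dA_i ∧ dx_i` of `ω = ∑ A_i dx_i`. -/
def extD {n : ℕ} (ω : Form1 n) : Form2 n :=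
  ∑ i, exteriorPower.ιMulti (S n) 2
    ![KaehlerDifferential.D ℂ (S n) (formCoeff ω i),
      KaehlerDifferential.D ℂ (S n) (MvPolynomial.X i)]

/-- `J(ω) = 𝒞(ω)`, the ideal generated by the coefficients of `ω`. -/
def singularIdeal {n : ℕ} (ω : Form1 n) : Ideal (S n) :=
  Ideal.span (Set.range (formCoeff ω))

/-- `𝒞(η)` for a `2`-form `η`: the ideal generated by its coefficients in the basis
`dx_i ∧ dx_j`, `i < j`. -/
def coeffIdeal2 {n : ℕ} (η : Form2 n) : Ideal (S n) :=
  Ideal.span (Set.range ((dxBasis n).exteriorPower (n := 2) |>.repr η))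

/-- `ω` represents an element of `ℱ¹(ℙⁿ, e)`: it is a global section of `Ω¹_{ℙⁿ}(e)` (its
coefficients are homogeneous of degree `e - 1` and its contraction with the radial field
`R = ∑ x_i ∂/∂x_i` vanishes), it is integrable, and its singular locus has codimension at least
two. The last condition forces `ω ≠ 0`. -/
structure IsFoliation {n : ℕ} (e : ℕ) (ω : Form1 n) : Prop where
  two_le : 2 ≤ e
  homogeneous : ∀ i, (formCoeff ω i).IsHomogeneous (e - 1)
  radial : ∑ i, MvPolynomial.X i * formCoeff ω i = 0
  integrable : ExteriorAlgebra.ι (S n) ω * (extD ω : ExteriorAlgebra (S n) (Form1 n)) = 0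
  codim : 2 ≤ (singularIdeal ω).height

/-- The standard grading of `S` by degree. -/
abbrev grading (n : ℕ) : ℕ → Submodule ℂ (S n) :=
  MvPolynomial.homogeneousSubmodule (Fin (n + 1)) ℂ

instance instGradedRing (n : ℕ) : GradedRing (grading n) := MvPolynomial.gradedAlgebra

/-- Complex projective space `ℙⁿ = Proj S`, as a scheme. -/
abbrev PP (n : ℕ) : Scheme := Proj (grading n)

/-- The homogeneous prime ideal of `S` which is the point `x` of `ℙⁿ`. -/
def pointIdeal {n : ℕ} (x : PP n) : Ideal (S n) :=
  (ProjectiveSpectrum.asHomogeneousIdeal (𝒜 := grading n) x).toIdeal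

instance instIsPrimePointIdeal {n : ℕ} (x : PP n) : (pointIdeal x).IsPrime :=
  ProjectiveSpectrum.isPrime (𝒜 := grading n) x

/-- The value of a section `s ∈ 𝒪(U)` at `x ∈ U`, as an element of the localization `S_x`
(it lies in the degree zero part). -/
def sectionAt {n : ℕ} (U : (PP n).Opens) (x : PP n) (hx : x ∈ U) :
    Γ(PP n, U) →+* Localization.AtPrime (pointIdeal x) :=
  (algebraMap (HomogeneousLocalization.AtPrime (grading n) (pointIdeal x))
    (Localization.AtPrime (pointIdeal x))).comp
    (openToLocalization (grading n) U x hx).hom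

/-- For `I ⊆ S` homogeneous, the ideal of `𝒪(U)` of those sections whose germ at every `x ∈ U`
lies in `I_x`; these are the sections of the ideal sheaf associated to `I`. -/
def sheafIdeal {n : ℕ} (I : Ideal (S n)) (U : (PP n).Opens) : Ideal Γ(PP n, U) :=
  ⨅ (x : PP n) (hx : x ∈ U), Ideal.comap (sectionAt U x hx)
    (Ideal.map (algebraMap (S n) (Localization.AtPrime (pointIdeal x))) I)

/-- The closed subscheme `Proj (S / I)` of `ℙⁿ` for `I ⊆ S` homogeneous, given by its
quasi-coherent ideal sheaf. -/
def projSubscheme {n : ℕ} (I : Ideal (S n)) : (PP n).IdealSheafData :=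
  Scheme.IdealSheafData.ofIdeals fun U => sheafIdeal I U.1

/-- The ideal `K(ω) = ann (dω mod J) + J`, where `dω mod J` lies in `Ω²_S ⊗ S/J(ω)`. -/
def kupkaIdeal {n : ℕ} (ω : Form1 n) : Ideal (S n) :=
  Ideal.torsionOf (S n) (Form2 n ⊗[S n] (S n ⧸ singularIdeal ω))
    (extD ω ⊗ₜ[S n] (1 : S n ⧸ singularIdeal ω)) ⊔ singularIdeal ω

/-- The Kupka scheme `𝒦(ω) = Proj (S / K(ω))`, as a closed subscheme of `ℙⁿ`. -/
def kupkaScheme {n : ℕ} (ω : Form1 n) : (PP n).IdealSheafData :=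
  projSubscheme (kupkaIdeal ω)

/-- `x ∈ ℙⁿ` is a Kupka point of `ω`: it is a singular point of `ω` and `dω` does not vanish
at `x`. -/
def IsKupkaPoint {n : ℕ} (ω : Form1 n) (x : PP n) : Prop :=
  singularIdeal ω ≤ pointIdeal x ∧ ¬ coeffIdeal2 (extD ω) ≤ pointIdeal x

/-- The Kupka set `𝒦_set`: the Zariski closure in `ℙⁿ` of the set of Kupka points. -/
def kupkaSet {n : ℕ} (ω : Form1 n) : Closeds (PP n) :=
  ⟨closure {x | IsKupkaPoint ω x}, isClosed_closure⟩

/-- The complex point of `ℙⁿ` with homogeneous coordinates `v ≠ 0` is a Kupka point of `ω`. -/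
def IsComplexKupkaPoint {n : ℕ} (ω : Form1 n) (v : Fin (n + 1) → ℂ) : Prop :=
  (∀ f ∈ singularIdeal ω, MvPolynomial.eval v f = 0) ∧
    ∃ f ∈ coeffIdeal2 (extD ω), MvPolynomial.eval v f ≠ 0

end KupkaFoliation

end

noncomputable section

namespace KupkaFoliation

/-! Since `Ω²_S` is free, `K(ω)` is the colon ideal `(J : 𝒞(dω))` (`mem_kupkaIdeal_iff`).

Equality of schemes: at a Kupka point some coefficient of `dω` is invertible, so `K` vanishes there.
Conversely, let `f`, without constant term, vanish at all Kupka points. For a coefficient `c` of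
`dω`, `f * c` lies in every homogeneous prime containing `J`, hence in `J` because `J` is radical;
so `f ∈ K`. Clearing denominators transfers this to sections.

Existence: contracting `dω` with the radial field gives `e • ω ≠ 0`, so some coefficient of `dω` is
nonzero. It has degree `e - 2`, while `J` is generated in degree `e - 1`, so it is not in the
radical ideal `J`, and the Nullstellensatz gives a zero of `J` where it survives. For `e = 2` that
zero might be the origin; there integrability shows that two linear forms cut out the zeros of `J`,
and `n ≥ 2` leaves a nonzero one. -/

variable {n e : ℕ} {ω : Form1 n}

/-! ### Coefficients of `dω`: integrability and Euler identities -/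

/-- The alternating form on `1`-forms given by the minor with columns `c`. -/
def minorForm (n k : ℕ) (c : Fin k → Fin (n + 1)) : Form1 n [⋀^Fin k]→ₗ[S n] S n :=
  Matrix.detRowAlternating.compLinearMap (LinearMap.pi fun a => (dxBasis n).coord (c a))

/-- The coefficient `∂_j A_k - ∂_k A_j` of `dx_j ∧ dx_k` in `dω`. -/
def curl {n : ℕ} (ω : Form1 n) (j k : Fin (n + 1)) : S n :=
  MvPolynomial.pderiv j (formCoeff ω k) - MvPolynomial.pderiv k (formCoeff ω j)

lemma minorForm_apply (k : ℕ) (c : Fin k → Fin (n + 1)) (v : Fin k → Form1 n) :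
    minorForm n k c v = (Matrix.of fun a b => (dxBasis n).repr (v a) (c b)).det := rfl

lemma dxBasis_repr_D (f : S n) (i : Fin (n + 1)) :
    (dxBasis n).repr (KaehlerDifferential.D ℂ (S n) f) i = MvPolynomial.pderiv i f :=
  KaehlerDifferential.mvPolynomialBasis_repr_apply ℂ _ _ _

lemma minorForm_two_extD (ω : Form1 n) (j k : Fin (n + 1)) :
    exteriorPower.alternatingMapLinearEquiv (minorForm n 2 ![j, k]) (extD ω) = curl ω j k := by
  simp [extD, curl, minorForm_apply, Matrix.det_fin_two, dxBasis_repr_D, MvPolynomial.pderiv_X,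
    Pi.single_apply, Finset.sum_sub_distrib]

lemma curl_mem_coeffIdeal2 (ω : Form1 n) (j k : Fin (n + 1)) :
    curl ω j k ∈ coeffIdeal2 (extD ω) := by
  rw [← minorForm_two_extD, ← ((dxBasis n).exteriorPower 2).sum_repr (extD ω), map_sum]
  refine Ideal.sum_mem _ fun s _ => ?_
  rw [map_smul, Module.Basis.sum_repr, smul_eq_mul]
  exact Ideal.mul_mem_right _ _ (Ideal.subset_span ⟨s, rfl⟩)

/-- This is the `dx_i ∧ dx_j ∧ dx_k` coefficient of `ω ∧ dω = 0`, extracted by a `3 × 3` minor. -/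
lemma formCoeff_mul_curl
    (h : ExteriorAlgebra.ι (S n) ω * (extD ω : ExteriorAlgebra (S n) (Form1 n)) = 0)
    (i j k : Fin (n + 1)) :
    formCoeff ω i * curl ω j k = formCoeff ω j * curl ω i k - formCoeff ω k * curl ω i j := by
  -- `liftAlternating` wants a form in every degree; only `m = 3`, with columns `i, j, k`, is used.
  let F : ∀ m, Form1 n [⋀^Fin m]→ₗ[S n] S n := fun m =>
    minorForm n m fun a => if a.val = 0 then i else if a.val = 1 then j else k
  have key := congrArg (ExteriorAlgebra.liftAlternating (R := S n) F) h
  have hmul : ∀ l, ExteriorAlgebra.ι (S n) ω *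
      (exteriorPower.ιMulti (S n) 2 ![KaehlerDifferential.D ℂ (S n) (formCoeff ω l),
        KaehlerDifferential.D ℂ (S n) (MvPolynomial.X l)] :
          ExteriorAlgebra (S n) (Form1 n)) =
      ExteriorAlgebra.ιMulti (S n) 3 ![ω, KaehlerDifferential.D ℂ (S n) (formCoeff ω l),
        KaehlerDifferential.D ℂ (S n) (MvPolynomial.X l)] := fun l => by
    simp [ExteriorAlgebra.ιMulti_apply]
  rw [extD, Submodule.coe_sum, Finset.mul_sum] at key
  simp only [hmul, map_sum, map_zero, ExteriorAlgebra.liftAlternating_apply_ιMulti] at key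
  simp only [F, minorForm_apply, Matrix.det_fin_three, Matrix.of_apply] at key
  simp [dxBasis_repr_D, MvPolynomial.pderiv_X,
    Pi.single_apply, Finset.sum_sub_distrib, Finset.sum_add_distrib] at key
  simp only [curl, formCoeff] at key ⊢
  linear_combination key

/-- Euler's formula contributes `e - 1` copies of `A_k`; differentiating `∑ x_i A_i = 0` contributes
the last one. -/
lemma IsFoliation.sum_X_mul_curl (hω : IsFoliation e ω) (k : Fin (n + 1)) :
    ∑ i, MvPolynomial.X i * curl ω i k = (e : S n) * formCoeff ω k := by
  have h1 := (hω.homogeneous k).sum_X_mul_pderiv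
  have h2 := congrArg (MvPolynomial.pderiv k) hω.radial
  simp only [map_sum, Derivation.leibniz, map_zero, MvPolynomial.pderiv_X, smul_eq_mul,
    Finset.sum_add_distrib, Pi.single_apply] at h2
  simp at h2
  obtain ⟨m, rfl⟩ := Nat.exists_eq_add_of_le hω.two_le
  simp only [curl, mul_sub, Finset.sum_sub_distrib, h1]
  simp only [show 2 + m - 1 = m + 1 by omega, nsmul_eq_mul]
  push_cast
  linear_combination -h2

lemma IsFoliation.formCoeff_ne_zero (hω : IsFoliation e ω) : ∃ k, formCoeff ω k ≠ 0 := by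
  by_contra! h
  have hJ : singularIdeal ω = ⊥ := by
    rw [singularIdeal, Ideal.span_eq_bot]
    rintro _ ⟨k, rfl⟩
    exact h k
  have := hω.codim
  rw [hJ, Ideal.height_bot] at this
  simp at this

lemma IsFoliation.exists_curl_ne_zero (hω : IsFoliation e ω) : ∃ j k, curl ω j k ≠ 0 := by
  by_contra! h
  obtain ⟨k, hk⟩ := hω.formCoeff_ne_zero
  have := hω.sum_X_mul_curl k
  simp only [h, mul_zero, Finset.sum_const_zero] at this
  have he : (e : S n) ≠ 0 := Nat.cast_ne_zero.2 (by have := hω.two_le; omega)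
  exact mul_ne_zero he hk this.symm

lemma IsFoliation.curl_isHomogeneous (hω : IsFoliation e ω) (j k : Fin (n + 1)) :
    (curl ω j k).IsHomogeneous (e - 2) := by
  have h := fun i l => (hω.homogeneous i).pderiv (i := l)
  exact (h k j).sub (h j k)

lemma IsFoliation.singularIdeal_isHomogeneous (hω : IsFoliation e ω) :
    (singularIdeal ω).IsHomogeneous (grading n) := by
  refine Ideal.homogeneous_span _ _ ?_
  rintro _ ⟨i, rfl⟩
  exact ⟨e - 1, hω.homogeneous i⟩

lemma IsFoliation.singularIdeal_le_pow (hω : IsFoliation e ω) :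
    singularIdeal ω ≤ MvPolynomial.idealOfVars (Fin (n + 1)) ℂ ^ (e - 1) := by
  rw [singularIdeal, Ideal.span_le]
  rintro _ ⟨i, rfl⟩
  rw [SetLike.mem_coe, MvPolynomial.mem_pow_idealOfVars_iff']
  intro x hx
  by_contra h
  have := (DFunLike.congr_fun Finsupp.degree_eq_weight_one x).trans (hω.homogeneous i h)
  omega

/-- Degrees decide: elements of `J` have no terms of degree below `e - 1`. -/
lemma IsFoliation.curl_notMem (hω : IsFoliation e ω) {j k : Fin (n + 1)}
    (h : curl ω j k ≠ 0) : curl ω j k ∉ singularIdeal ω := fun hmem => by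
  have h1 := hω.singularIdeal_le_pow hmem
  rw [MvPolynomial.mem_pow_idealOfVars_iff] at h1
  obtain ⟨d, hd⟩ := MvPolynomial.ne_zero_iff.1 h
  have h2 := (DFunLike.congr_fun Finsupp.degree_eq_weight_one d).trans
    (hω.curl_isHomogeneous j k hd)
  have h3 := h1 d (MvPolynomial.mem_support_iff.2 hd)
  have := hω.two_le
  omega

/-- The ideal `K(ω)` is the colon ideal of `J(ω)` by the coefficients of `dω`. -/
lemma mem_kupkaIdeal_iff (ω : Form1 n) (f : S n) :
    f ∈ kupkaIdeal ω ↔ ∀ c ∈ coeffIdeal2 (extD ω), f * c ∈ singularIdeal ω := by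
  have hle : singularIdeal ω ≤ Ideal.torsionOf (S n) (Form2 n ⊗[S n] (S n ⧸ singularIdeal ω))
      (extD ω ⊗ₜ[S n] (1 : S n ⧸ singularIdeal ω)) := fun a ha => by
    have h0 : a • (1 : S n ⧸ singularIdeal ω) = 0 :=
      (Submodule.Quotient.mk_eq_zero _).2 (by simpa using ha)
    rw [Ideal.mem_torsionOf_iff, ← TensorProduct.tmul_smul, h0, TensorProduct.tmul_zero]
  -- Through `M ⊗ S/J ≅ M/JM`, the condition becomes `f • dω ∈ J • Ω²_S`, which is tested on
  -- coordinates.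
  rw [kupkaIdeal, sup_eq_left.2 hle, Ideal.mem_torsionOf_iff, TensorProduct.smul_tmul',
    ← TensorProduct.tensorQuotEquivQuotSMul_symm_mk, LinearEquiv.map_eq_zero_iff,
    Submodule.Quotient.mk_eq_zero]
  set b := (dxBasis n).exteriorPower 2
  constructor
  · intro h c hc
    have hcoord : ∀ s, b.repr (f • extD ω) s ∈ singularIdeal ω := fun s => by
      refine Submodule.smul_induction_on h (fun r hr m _ => ?_) fun x y hx hy => ?_
      · simpa using Ideal.mul_mem_right _ _ hr
      · simpa using Ideal.add_mem _ hx hy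
    refine Submodule.span_induction (fun x hx => ?_) (by simp) (fun x y _ _ hx hy => ?_)
      (fun a x _ hx => ?_) hc
    · obtain ⟨s, rfl⟩ := hx
      simpa using hcoord s
    · rw [mul_add]
      exact Ideal.add_mem _ hx hy
    · rw [smul_eq_mul, mul_left_comm]
      exact Ideal.mul_mem_left _ _ hx
  · intro h
    rw [← b.sum_repr (f • extD ω)]
    refine Submodule.sum_mem _ fun s _ => Submodule.smul_mem_smul ?_ trivial
    simpa using h _ (Ideal.subset_span ⟨s, rfl⟩)

/-! ### Existence of Kupka points -/

lemma exists_ne_zero_eval_eq_zero_of_isHomogeneous_one (hn : 2 ≤ n) {f g : S n}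
    (hf : f.IsHomogeneous 1) (hg : g.IsHomogeneous 1) :
    ∃ v : Fin (n + 1) → ℂ, v ≠ 0 ∧ MvPolynomial.eval v f = 0 ∧ MvPolynomial.eval v g = 0 := by
  let lin : S n → (Fin (n + 1) → ℂ) →ₗ[ℂ] ℂ := fun p =>
    ∑ i, MvPolynomial.coeff 0 (MvPolynomial.pderiv i p) • LinearMap.proj i
  have hlin : ∀ p : S n, p.IsHomogeneous 1 → ∀ v, lin p v = MvPolynomial.eval v p := by
    intro p hp v
    have h1 := congrArg (MvPolynomial.eval v) hp.sum_X_mul_pderiv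
    rw [one_smul] at h1
    rw [← h1]
    simp only [lin, LinearMap.sum_apply, LinearMap.smul_apply, LinearMap.proj_apply, smul_eq_mul,
      map_sum, map_mul, MvPolynomial.eval_X]
    refine Finset.sum_congr rfl fun i _ => ?_
    have h2 : (MvPolynomial.pderiv i p).totalDegree = 0 :=
      Nat.le_zero.1 (hp.pderiv (i := i)).totalDegree_le
    rw [MvPolynomial.totalDegree_eq_zero_iff_eq_C] at h2
    conv_rhs => rw [h2, MvPolynomial.eval_C]
    ring
  have hker : LinearMap.ker ((lin f).prod (lin g)) ≠ ⊥ :=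
    LinearMap.ker_ne_bot_of_finrank_lt (by simp; omega)
  obtain ⟨v, hv, hv0⟩ := Submodule.exists_mem_ne_zero_of_ne_bot hker
  have hv' : (lin f v, lin g v) = 0 := hv
  exact ⟨v, hv0, (hlin f hf v).symm.trans (congrArg Prod.fst hv'),
    (hlin g hg v).symm.trans (congrArg Prod.snd hv')⟩

lemma IsFoliation.exists_point_curl_ne_zero (hn : 2 ≤ n) (hω : IsFoliation e ω)
    (hJ : (singularIdeal ω).IsRadical) {j k : Fin (n + 1)} (h : curl ω j k ≠ 0) :
    ∃ v : Fin (n + 1) → ℂ, v ≠ 0 ∧ (∀ f ∈ singularIdeal ω, MvPolynomial.eval v f = 0) ∧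
      MvPolynomial.eval v (curl ω j k) ≠ 0 := by
  have hc := hω.curl_isHomogeneous j k
  rcases hω.two_le.eq_or_lt with he | he
  -- Here `curl ω j k` is a nonzero constant, so by integrability the zeros of `A_j` and `A_k` kill
  -- every `A_i`.
  · obtain rfl := he
    have hconst : curl ω j k = MvPolynomial.C ((curl ω j k).coeff 0) :=
      MvPolynomial.totalDegree_eq_zero_iff_eq_C.1 (Nat.le_zero.1 hc.totalDegree_le)
    obtain ⟨v, hv, hvj, hvk⟩ := exists_ne_zero_eval_eq_zero_of_isHomogeneous_one hn
      (hω.homogeneous j) (hω.homogeneous k)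
    have hne : MvPolynomial.eval v (curl ω j k) ≠ 0 := fun h0 => h <| by
      rw [hconst, MvPolynomial.eval_C] at h0
      rw [hconst, h0, map_zero]
    refine ⟨v, hv, fun f hf => ?_, hne⟩
    have hle : singularIdeal ω ≤ RingHom.ker (MvPolynomial.eval v) := by
      rw [singularIdeal, Ideal.span_le]
      rintro _ ⟨i, rfl⟩
      have h1 := congrArg (MvPolynomial.eval v) (formCoeff_mul_curl hω.integrable i j k)
      simp only [map_mul, map_sub, hvj, hvk, zero_mul, sub_zero] at h1
      exact (mul_eq_zero.1 h1).resolve_right hne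
    exact hle hf
  · have hnot : curl ω j k ∉
        MvPolynomial.vanishingIdeal ℂ (MvPolynomial.zeroLocus ℂ (singularIdeal ω)) := by
      rw [MvPolynomial.vanishingIdeal_zeroLocus_eq_radical, hJ.radical]
      exact hω.curl_notMem h
    simp only [MvPolynomial.mem_vanishingIdeal_iff, not_forall] at hnot
    obtain ⟨v, hv, hcv⟩ := hnot
    -- The curl has positive degree `e - 2`, so it would vanish at the origin.
    refine ⟨v, fun hv0 => hcv ?_, fun f hf => hv f hf, hcv⟩
    have := hc.coeff_eq_zero (d := 0) (by simp; omega)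
    rw [hv0]
    simpa [MvPolynomial.aeval_zero, MvPolynomial.constantCoeff_eq] using this

/-- The point of `ℙⁿ` with homogeneous coordinates `v`. -/
def pointOfCoords (v : Fin (n + 1) → ℂ) (hv : v ≠ 0) : PP n where
  -- The kernel of evaluation is not homogeneous; its homogeneous core is the ideal of the line
  -- through `v`.
  asHomogeneousIdeal := (RingHom.ker (MvPolynomial.eval v)).homogeneousCore (grading n)
  isPrime := (RingHom.ker_isPrime (MvPolynomial.eval v)).homogeneousCore
  not_irrelevant_le h := hv <| by
    funext i
    have hX : (MvPolynomial.X i : S n) ∈ (HomogeneousIdeal.irrelevant (grading n)) := by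
      rw [HomogeneousIdeal.mem_irrelevant_iff, GradedRing.proj_apply,
        DirectSum.decompose_of_mem_ne (i := 1) _ (MvPolynomial.isHomogeneous_X ℂ i) one_ne_zero]
    simpa using Ideal.toIdeal_homogeneousCore_le _ _ (h hX)

lemma pointIdeal_pointOfCoords (v : Fin (n + 1) → ℂ) (hv : v ≠ 0) :
    pointIdeal (pointOfCoords v hv) =
      ((RingHom.ker (MvPolynomial.eval v)).homogeneousCore (grading n)).toIdeal := rfl

lemma IsFoliation.exists_kupkaPoint (hn : 2 ≤ n) (hω : IsFoliation e ω)
    (hJ : (singularIdeal ω).IsRadical) :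
    (∃ x, IsKupkaPoint ω x) ∧ ∃ v : Fin (n + 1) → ℂ, v ≠ 0 ∧ IsComplexKupkaPoint ω v := by
  obtain ⟨j, k, hjk⟩ := hω.exists_curl_ne_zero
  obtain ⟨v, hv, hvJ, hvc⟩ := hω.exists_point_curl_ne_zero hn hJ hjk
  refine ⟨⟨pointOfCoords v hv, ?_, fun h => hvc ?_⟩,
    v, hv, hvJ, _, curl_mem_coeffIdeal2 ω j k, hvc⟩
  · rw [pointIdeal_pointOfCoords, singularIdeal, Ideal.span_le]
    rintro _ ⟨i, rfl⟩
    exact Ideal.mem_homogeneousCore_of_homogeneous_of_mem ⟨_, hω.homogeneous i⟩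
      (hvJ _ (Ideal.subset_span ⟨i, rfl⟩))
  · exact Ideal.toIdeal_homogeneousCore_le _ _ (h (curl_mem_coeffIdeal2 ω j k))

/-! ### Homogeneous primes and local sections -/

lemma exists_X_notMem_pointIdeal (x : PP n) :
    ∃ i, (MvPolynomial.X i : S n) ∉ pointIdeal x := by
  by_contra! h
  refine ProjectiveSpectrum.not_irrelevant_le (𝒜 := grading n) x ?_
  intro f hf
  rw [HomogeneousIdeal.mem_irrelevant_iff, GradedRing.proj_apply] at hf
  have h0 : MvPolynomial.coeff 0 f = 0 := by
    have := congrArg (MvPolynomial.coeff 0)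
      ((MvPolynomial.decomposition.decompose'_apply f 0).symm.trans hf)
    simpa [MvPolynomial.coeff_homogeneousComponent] using this
  have hle : MvPolynomial.idealOfVars (Fin (n + 1)) ℂ ≤ pointIdeal x := by
    rw [MvPolynomial.idealOfVars, Ideal.span_le]
    rintro _ ⟨i, rfl⟩
    exact h i
  refine hle ?_
  rw [← pow_one (MvPolynomial.idealOfVars _ _), MvPolynomial.mem_pow_idealOfVars_iff']
  intro d hd
  rw [(Finsupp.degree_eq_zero_iff d).1 (by omega), h0]

/-- Any prime over the homogeneous ideal `J` contains its homogeneous core, which is a prime still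
over `J`. -/
lemma mem_of_forall_homogeneous_prime {J : Ideal (S n)} (hJ : J.IsRadical)
    (hhom : J.IsHomogeneous (grading n)) {f : S n}
    (h : ∀ p : Ideal (S n), p.IsPrime → p.IsHomogeneous (grading n) → J ≤ p → f ∈ p) :
    f ∈ J := by
  rw [← hJ.radical, Ideal.radical_eq_sInf, Submodule.mem_sInf]
  rintro p ⟨hle, hp⟩
  refine Ideal.toIdeal_homogeneousCore_le (grading n) p
    (h _ hp.homogeneousCore (Ideal.homogeneousCore (grading n) p).isHomogeneous ?_)
  rw [← hhom.toIdeal_homogeneousCore_eq_self]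
  exact Ideal.homogeneousCore_mono _ hle

lemma mem_basicOpen_iff_isUnit_sectionAt (U : (PP n).Opens) (x : PP n) (hx : x ∈ U)
    (s : Γ(PP n, U)) : x ∈ (PP n).basicOpen s ↔ IsUnit (sectionAt U x hx s) := by
  rw [Scheme.mem_basicOpen _ _ _ hx]
  have h1 : (Proj.stalkIso' (grading n) x) ((PP n).presheaf.germ U x hx s) =
      (openToLocalization (grading n) U x hx).hom s :=
    Proj.stalkIso'_germ (grading n) U x hx s
  have h2 : sectionAt U x hx s = HomogeneousLocalization.val
      (Proj.stalkIso' (grading n) x ((PP n).presheaf.germ U x hx s)) :=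
    congrArg HomogeneousLocalization.val h1.symm
  rw [h2]
  exact (MulEquiv.isUnit_map (Proj.stalkIso' (grading n) x)).symm.trans
    (HomogeneousLocalization.isUnit_iff_isUnit_val (grading n) (pointIdeal x) _).symm

/-- A section is locally a fraction of homogeneous polynomials, on a standard open set. -/
lemma exists_eq_fraction (U : (PP n).Opens) (x : PP n) (hx : x ∈ U) (s : Γ(PP n, U)) :
    ∃ g a b : S n, g ∉ pointIdeal x ∧ (∀ y, g ∉ pointIdeal y → ∃ hy : y ∈ U,
      b ∉ pointIdeal y ∧
      sectionAt U y hy s * algebraMap (S n) _ b = algebraMap (S n) _ a) := by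
  obtain ⟨V, hxV, i, d, r, t, hnot, heq⟩ := s.2 ⟨x, hx⟩
  obtain ⟨_, ⟨g, rfl⟩, hxg, hgV⟩ :=
    (ProjectiveSpectrum.isTopologicalBasis_basic_opens (grading n)).exists_subset_of_mem_open
      hxV V.2
  refine ⟨g, r.1, t.1, hxg, fun y hy => ⟨i.le (hgV hy), hnot ⟨y, hgV hy⟩, ?_⟩⟩
  have h := heq ⟨y, hgV hy⟩
  have h2 : sectionAt U y (i.le (hgV hy)) s = Localization.mk r.1 ⟨t.1, hnot ⟨y, hgV hy⟩⟩ :=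
    congrArg HomogeneousLocalization.val h
  rw [h2, Localization.mk_eq_mk']
  exact IsLocalization.mk'_spec _ _ _

lemma kupkaIdeal_le_pointIdeal {x : PP n} (hx : IsKupkaPoint ω x) :
    kupkaIdeal ω ≤ pointIdeal x := by
  intro f hf
  obtain ⟨c, hc, hcx⟩ := SetLike.not_le_iff_exists.1 hx.2
  exact ((instIsPrimePointIdeal x).mem_or_mem
    (hx.1 ((mem_kupkaIdeal_iff ω f).1 hf c hc))).resolve_right hcx

/-- `hirr` handles the primes containing the irrelevant ideal, which are not points of `ℙⁿ`. -/
lemma mem_kupkaIdeal_of_forall_kupkaPoint (hJ : (singularIdeal ω).IsRadical)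
    (hhom : (singularIdeal ω).IsHomogeneous (grading n)) {f : S n}
    (hirr : f ∈ MvPolynomial.idealOfVars (Fin (n + 1)) ℂ)
    (h : ∀ x, IsKupkaPoint ω x → f ∈ pointIdeal x) : f ∈ kupkaIdeal ω := by
  refine (mem_kupkaIdeal_iff ω f).2 fun c hc => mem_of_forall_homogeneous_prime hJ hhom ?_
  intro p hp hph hle
  by_cases hcp : c ∈ p
  · exact Ideal.mul_mem_left _ _ hcp
  refine Ideal.mul_mem_right _ _ ?_
  by_cases hirrp : MvPolynomial.idealOfVars (Fin (n + 1)) ℂ ≤ p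
  · exact hirrp hirr
  refine h (⟨⟨p, hph⟩, hp, fun hle' => hirrp ?_⟩ : PP n) ⟨hle, fun h' => hcp (h' hc)⟩
  rw [MvPolynomial.idealOfVars, Ideal.span_le]
  rintro _ ⟨i, rfl⟩
  refine hle' ?_
  rw [HomogeneousIdeal.mem_irrelevant_iff, GradedRing.proj_apply,
    DirectSum.decompose_of_mem_ne (i := 1) _ (MvPolynomial.isHomogeneous_X ℂ i) one_ne_zero]

/-! ### The two inclusions of ideal sheaves -/

lemma kupkaScheme_le_vanishingIdeal (ω : Form1 n) :
    kupkaScheme ω ≤ Scheme.IdealSheafData.vanishingIdeal (kupkaSet ω) := by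
  rw [← Scheme.IdealSheafData.le_support_iff_le_vanishingIdeal]
  refine closure_minimal (fun x hx => ?_) (kupkaScheme ω).support.isClosed
  refine Scheme.IdealSheafData.mem_support_iff.2 fun U => ?_
  rw [Scheme.mem_zeroLocus_iff]
  intro s hs hxs
  have hxU : x ∈ U.1 := (PP n).basicOpen_le s hxs
  have h1 : s ∈ sheafIdeal (kupkaIdeal ω) U.1 :=
    Scheme.IdealSheafData.ideal_ofIdeals_le _ U hs
  simp only [sheafIdeal, Submodule.mem_iInf] at h1
  have h3 := Ideal.map_mono (f := algebraMap (S n) (Localization.AtPrime (pointIdeal x)))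
    (kupkaIdeal_le_pointIdeal hx) (Ideal.mem_comap.1 (h1 x hxU))
  rw [Localization.AtPrime.map_eq_maximalIdeal] at h3
  exact h3 ((mem_basicOpen_iff_isUnit_sectionAt U.1 x hxU s).1 hxs)

lemma vanishingIdeal_le_kupkaScheme (hJ : (singularIdeal ω).IsRadical)
    (hhom : (singularIdeal ω).IsHomogeneous (grading n)) :
    Scheme.IdealSheafData.vanishingIdeal (kupkaSet ω) ≤ kupkaScheme ω := by
  -- `ofIdeals` is the largest ideal sheaf inside the given family, so sections suffice.
  refine Scheme.IdealSheafData.le_ofIdeals_iff.2 fun U s hs => ?_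
  have hvan : ∀ y, IsKupkaPoint ω y → ∀ hy : y ∈ U.1, ¬ IsUnit (sectionAt U.1 y hy s) := by
    intro y hy hyU hunit
    have hle := Scheme.IdealSheafData.le_support_iff_le_vanishingIdeal.2
      (le_refl (Scheme.IdealSheafData.vanishingIdeal (kupkaSet ω)))
    have h1 := Scheme.IdealSheafData.mem_support_iff.1 (hle (subset_closure hy)) U
    rw [Scheme.mem_zeroLocus_iff] at h1
    exact h1 s hs ((mem_basicOpen_iff_isUnit_sectionAt U.1 y hyU s).2 hunit)
  simp only [sheafIdeal, Submodule.mem_iInf]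
  intro x hx
  rw [Ideal.mem_comap]
  obtain ⟨g, a, b, hgx, hfrac⟩ := exists_eq_fraction U.1 x hx s
  obtain ⟨i, hi⟩ := exists_X_notMem_pointIdeal x
  -- `g` kills the points where `s = a / b` may fail and `X i` removes the constant term; both are
  -- units at `x`.
  have hmem : MvPolynomial.X i * (g * a) ∈ kupkaIdeal ω := by
    refine mem_kupkaIdeal_of_forall_kupkaPoint hJ hhom
      (Ideal.mul_mem_right _ _ (Ideal.subset_span ⟨i, rfl⟩)) fun y hy => ?_
    refine Ideal.mul_mem_left _ _ ?_
    by_cases hgy : g ∈ pointIdeal y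
    · exact Ideal.mul_mem_right _ _ hgy
    refine Ideal.mul_mem_left _ _ ?_
    obtain ⟨hyU, hb, heq⟩ := hfrac y hgy
    by_contra ha
    have hu := IsLocalization.map_units (Localization.AtPrime (pointIdeal y))
      (⟨a, ha⟩ : (pointIdeal y).primeCompl)
    exact hvan y hy hyU (isUnit_of_mul_isUnit_left (heq ▸ hu))
  obtain ⟨_, hb, heq⟩ := hfrac x hgx
  have hunit : IsUnit (algebraMap (S n) (Localization.AtPrime (pointIdeal x))
      (MvPolynomial.X i * g * b)) :=
    IsLocalization.map_units _ (⟨_, mul_mem (mul_mem (show _ ∈ (pointIdeal x).primeCompl from hi)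
      (show _ ∈ (pointIdeal x).primeCompl from hgx)) hb⟩ : (pointIdeal x).primeCompl)
  rw [← Ideal.mul_unit_mem_iff_mem _ hunit]
  have := Ideal.mem_map_of_mem (algebraMap (S n) (Localization.AtPrime (pointIdeal x))) hmem
  convert this using 1
  rw [map_mul _ (_ * _) b, mul_comm (algebraMap _ _ (_ * _)), ← mul_assoc, heq]
  simp only [map_mul]
  ring

end KupkaFoliation

end

open KupkaFoliation in
theorem theorem4 (n e : ℕ) (hn : 2 ≤ n) (ω : Form1 n) (hω : IsFoliation e ω)
    (hJ : (singularIdeal ω).IsRadical) :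
    kupkaScheme ω = AlgebraicGeometry.Scheme.IdealSheafData.vanishingIdeal (kupkaSet ω) ∧
      (kupkaSet ω : Set (PP n)).Nonempty ∧
      ∃ v : Fin (n + 1) → ℂ, v ≠ 0 ∧ IsComplexKupkaPoint ω v := by
  obtain ⟨⟨x, hx⟩, hv⟩ := hω.exists_kupkaPoint hn hJ
  exact ⟨le_antisymm (kupkaScheme_le_vanishingIdeal ω)
    (vanishingIdeal_le_kupkaScheme hJ hω.singularIdeal_isHomogeneous), ⟨x, subset_closure hx⟩, hv⟩
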